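/- Let $\Gamma\subset\mathbb{R}^2$ be a nonempty set (a possibly irregular lattice) for which there is an injective map $F:\Gamma\to\mathbb{Z}^2$ with $|F(\gamma)-\gamma|<\tfrac12$ for all $\gamma\in\Gamma$. For a bounded operator $T$ on $l^2(\Gamma)$ let $T(x,x')=\langle T\delta_{x'},\delta_x\rangle$, $x,x'\in\Gamma$, be its kernel, where $\{\delta_x\}_{x\in\Gamma}$ is the canonical basis and the inner product is linear in its first argument. For $\alpha\ge 0$ let $\mathcal{H}^\alpha$ be the set of bounded self-adjoint operators $T$ on $l^2(\Gamma)$ with $$\sup_{x'\in\Gamma}\Big\{\sum_{x\in\Gamma}(1+|x-x'|^2)^{\alpha}\,|T(x,x')|^2\Big\}^{1/2}<\infty .$$ Put $\varphi(x,x')=-\tfrac12(x_1x_2'-x_2x_1')$. **Theorem 1.** Let $\alpha>3$ and $K\in\mathcal{H}^\alpha$. Then for every $b\in\mathbb{R}$ the kernel $e^{ib\varphi(x,x')}K(x,x')$ is the kernel of a (unique) bounded self-adjoint operator $K_b$ on $l^2(\Gamma)$, and the following hold. (i) The resolvent set is stable: for every $b_0\in\mathbb{R}$ and $\epsilon>0$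 there exist $\delta>0$ and $\eta>0$ such that, for every $z\in\mathbb{C}$ with $\mathrm{dist}(z,\sigma(K_{b_0}))\ge\epsilon$, one has $\mathrm{dist}(z,\sigma(K_b))\ge\eta$ whenever $|b-b_0|<\delta$. (ii) The functions $E_+(b)=\sup\sigma(K_b)$ and $E_-(b)=\inf\sigma(K_b)$ are Lipschitz on $\mathbb{R}$. (iii) Suppose moreover that $\alpha>4$. Let $I=[p,q]$ be a closed bounded interval and $b_0\in I$, and let $(a,c)$, $a<c$, be a gap of $K_{b_0}$, that is, $a,c\in\sigma(K_{b_0})$ and $(a,c)\cap\sigma(K_{b_0})=\emptyset$. Suppose that this gap does not close on $I$, in the sense that there is a continuous function $\gamma:I\to\mathbb{R}$ with $\gamma(b_0)\in(a,c)$ and $\gamma(b)\notin\sigma(K_b)$ for all $b\in I$. Then there are functions $e_-,e_+$ on $I$, Lipschitz on $I$, with $e_-(b_0)=a$ and $e_+(b_0)=c$, such that for every $b\in I$ the interval $(e_-(b),e_+(b))$ is a gap of $K_b$ containing $\gamma(b)$: $e_-(b)<\gamma(b)<e_+(b)$, $e_\pm(b)\in\sigma(K_b)$ and $(e_-(b),e_+(b))\cap\sigma(K_b)=\emptyset$.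 -/

import Mathlib

open scoped ENNReal NNReal

namespace HarperLike

/-- The Euclidean plane. -/
abbrev Plane : Type := EuclideanSpace ℝ (Fin 2)

/-- `Γ` is a (possibly irregular) lattice close to `ℤ²`: there is an injective map
`F : Γ → ℤ²` with `|F γ - γ| < 1/2` (Euclidean norm). -/
def IsNearIntegerLattice (Γ : Set Plane) : Prop :=
  ∃ F : Γ → (Fin 2 → ℤ), Function.Injective F ∧
    ∀ γ : Γ, ‖(WithLp.toLp 2 (fun i => (F γ i : ℝ)) : Plane) - (γ : Plane)‖ < 1 / 2

/-- The Hilbert space `l²(Γ)` of complex square-summable functions on `Γ`. -/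
abbrev Ell2 (Γ : Set Plane) : Type := lp (fun _ : Γ => ℂ) 2

/-- The bounded operators on `l²(Γ)`. -/
abbrev Op (Γ : Set Plane) : Type := Ell2 Γ →L[ℂ] Ell2 Γ

open scoped Classical in
/-- The kernel `T(x, x') = ⟨T δ_{x'}, δ_x⟩ = (T δ_{x'})(x)` of a bounded operator `T`. -/
noncomputable def kernel {Γ : Set Plane} (T : Op Γ) (x x' : Γ) : ℂ :=
  (T (lp.single 2 x' (1 : ℂ)) : Γ → ℂ) x

open scoped Classical in
/-- A bounded operator is determined by its kernel. -/
theorem kernel_injective {Γ : Set Plane} : Function.Injective (kernel : Op Γ → Γ → Γ → ℂ) := by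
  intro S T h
  refine lp.ext_continuousLinearMap (by norm_num) fun x' => ?_
  apply ContinuousLinearMap.ext_ring
  ext x
  have := congrFun (congrFun h x) x'
  simpa [kernel] using this

/-- The weight `⟨v⟩^α = (1 + |v|²)^(α/2)`. -/
noncomputable def bracketPow (α : ℝ) (v : Plane) : ℝ := (1 + ‖v‖ ^ 2) ^ (α / 2)

/-- The `ℋ^α`-norm
`sup_{x'} (∑_x ⟨x - x'⟩^{2α} |T(x, x')|²)^{1/2}`, with values in `[0, ∞]`. -/
noncomputable def hNorm {Γ : Set Plane} (α : ℝ) (T : Op Γ) : ℝ≥0∞ :=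
  ⨆ x' : Γ, (∑' x : Γ, ENNReal.ofReal
    (bracketPow (2 * α) ((x : Plane) - (x' : Plane)) * ‖kernel T x x'‖ ^ 2)) ^ (1 / 2 : ℝ)

/-- The class `ℋ^α` of bounded self-adjoint operators with finite `ℋ^α`-norm. -/
def MemH {Γ : Set Plane} (α : ℝ) (T : Op Γ) : Prop :=
  IsSelfAdjoint T ∧ hNorm α T < ∞

/-- The flux `φ(x, x') = -(x₁ x₂' - x₂ x₁') / 2` of a unit magnetic field through the triangle
with vertices `x`, `x'` and the origin. -/
noncomputable def flux (x x' : Plane) : ℝ := -(1 / 2) * (x 0 * x' 1 - x 1 * x' 0)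

/-- The kernel `e^{i b φ(x, x')} K(x, x')`. -/
noncomputable def harperKernel {Γ : Set Plane} (K : Op Γ) (b : ℝ) (x x' : Γ) : ℂ :=
  Complex.exp (Complex.I * b * flux x x') * kernel K x x'

open scoped Classical in
/-- The bounded operator on `l²(Γ)` whose kernel is `k` (unique by `kernel_injective`), and `0` if there is no bounded operator with that kernel. -/
noncomputable def opOfKernel {Γ : Set Plane} (k : Γ → Γ → ℂ) : Op Γ :=
  if h : ∃ T : Op Γ, kernel T = k then h.choose else 0

/-- The Harper-like operator `K_b`, given by the kernel `e^{i b φ(x, x')} K(x, x')`. -/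
noncomputable def harper {Γ : Set Plane} (K : Op Γ) (b : ℝ) : Op Γ :=
  opOfKernel (harperKernel K b)

/-- `(a, c)` is a (bounded, nonempty) gap of the set `S ⊆ ℝ`, with edges `a, c ∈ S`. -/
def IsGap (S : Set ℝ) (a c : ℝ) : Prop :=
  a < c ∧ a ∈ S ∧ c ∈ S ∧ Disjoint (Set.Ioo a c) S

end HarperLike

/-!
Multiplying a kernel pointwise by the Landau kernel
`G(x, x') = e^{i t φ(x, x')} e^{-|t| |x - x'|² / 4}` preserves positivity of the quadratic form:
`G` is, up to a rank-one factor, the exponential of a Gram kernel (`exists_landau_eq`), so expanding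
the exponential writes the new form as a sum of values of the old one
(`finiteForm_mul_landau_nonneg`). Moreover `G` is `1` on the diagonal.

Let `t = b - b₀` and suppose `w l² + u l ≥ m` on the spectrum of `K_{b₀}`, so that
`w K_{b₀}² + u K_{b₀} - m ≥ 0`. The Schur product of the kernel of this operator with `G` is again
positive, and it agrees with the kernel of `w K_b² + u K_b - m` up to an error of size
`(|w| + |u|) |t|` in the norm of the Schur test. Indeed, the Gaussian differs from `1` by at most
`|t| |x - x'|² / 4`, and passing from `K_{b₀}²` to `K_b²` multiplies the contribution of the path
`x, y, x'` by a phase that differs from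
`e^{i t φ(x, x')}` by the flux of `t` through the triangle `x, y, x'`, at most
`|t| |x - y| |y - x'| / 2`; so second moments of `K` control everything, and `α > 3` makes them
finite because lattice sums over `Γ` are comparable with those over `ℤ²`
(`MemH.exists_sum_moment_le`). The result is `spectrum_quadratic_lower_bound`: a lower bound of
a quadratic polynomial on the spectrum persists from `b₀` to `b` up to `O((|w| + |u|) |b - b₀|)`.

Everything else only uses this property of the family of spectra (`IsQuadraticallyStable`). Linear
polynomials give the Lipschitz continuity of the spectral extremes, `|z - l|²` gives the stability
of the resolvent set, and `(l - a) (l - c)`, which is nonnegative on the spectrum exactly when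
`(a, c)` contains no point of it, gives Lipschitz gap edges with a constant inversely proportional
to the distance `d` of the curve `γ` to the spectrum. Compactness bounds `d` from below, and the
intermediate value theorem keeps spectrum on both sides of `γ`.
-/

namespace HarperLike

open Complex ComplexConjugate

/-! ### Operators and their kernels -/

section Kernel

variable {Γ : Set Plane}

open scoped Classical in
theorem hasSum_kernel_mul (T : Op Γ) (ψ : Ell2 Γ) (x : Γ) :
    HasSum (fun y => kernel T x y * ψ y) (T ψ x) := by
  have hy (y : Γ) : (lp.single 2 y (ψ y) : Ell2 Γ) = ψ y • lp.single 2 y (1 : ℂ) := by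
    rw [← lp.single_smul, smul_eq_mul, mul_one]
  have h := ((lp.evalCLM ℂ (fun _ : Γ => ℂ) 2 x).comp T).hasSum
    (lp.hasSum_single (by norm_num) ψ)
  simp only [hy, map_smul, smul_eq_mul, mul_comm (ψ _)] at h
  exact h

open scoped Classical in
theorem kernel_mul (S T : Op Γ) (x x' : Γ) :
    kernel (S * T) x x' = ∑' y, kernel S x y * kernel T y x' :=
  (hasSum_kernel_mul S (T (lp.single 2 x' 1)) x).tsum_eq.symm

theorem kernel_add (S T : Op Γ) (x x' : Γ) :
    kernel (S + T) x x' = kernel S x x' + kernel T x x' := by simp [kernel]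

theorem kernel_sub (S T : Op Γ) (x x' : Γ) :
    kernel (S - T) x x' = kernel S x x' - kernel T x x' := by simp [kernel]

theorem kernel_smul (r : ℝ) (T : Op Γ) (x x' : Γ) :
    kernel (r • T) x x' = r * kernel T x x' := by simp [kernel]

theorem kernel_one_self (x : Γ) : kernel (1 : Op Γ) x x = 1 := by simp [kernel]

theorem kernel_one_of_ne {x x' : Γ} (h : x ≠ x') : kernel (1 : Op Γ) x x' = 0 := by
  simp [kernel, h]

open scoped Classical in
theorem kernel_eq_inner (T : Op Γ) (x x' : Γ) :
    kernel T x x' = inner ℂ (lp.single 2 x (1 : ℂ)) (T (lp.single 2 x' (1 : ℂ))) := by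
  simp [kernel, lp.inner_single_left]

theorem kernel_adjoint (T : Op Γ) (x x' : Γ) :
    kernel (ContinuousLinearMap.adjoint T) x x' = conj (kernel T x' x) := by
  rw [kernel_eq_inner, kernel_eq_inner, ContinuousLinearMap.adjoint_inner_right, inner_conj_symm]

theorem isSelfAdjoint_iff_kernel (T : Op Γ) :
    IsSelfAdjoint T ↔ ∀ x x', kernel T x x' = conj (kernel T x' x) := by
  rw [ContinuousLinearMap.isSelfAdjoint_iff']
  constructor
  · intro h x x'
    rw [← kernel_adjoint, h]
  · intro h
    refine kernel_injective (funext₂ fun x x' => ?_)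
    rw [kernel_adjoint, ← h]

theorem kernel_opOfKernel {k : Γ → Γ → ℂ} (h : ∃ T : Op Γ, kernel T = k) :
    kernel (opOfKernel k) = k := by
  rw [opOfKernel, dif_pos h]
  exact h.choose_spec

/-- The sesquilinear expression `∑_{x, x' ∈ s} conj (c x) k(x, x') c x'`. -/
noncomputable def finiteForm (s : Finset Γ) (k : Γ → Γ → ℂ) (c : Γ → ℂ) : ℂ :=
  ∑ x ∈ s, ∑ x' ∈ s, conj (c x) * k x x' * c x'

open scoped Classical in
theorem finiteForm_kernel (s : Finset Γ) (T : Op Γ) (c : Γ → ℂ) :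
    finiteForm s (kernel T) c =
      inner ℂ (∑ x ∈ s, lp.single 2 x (c x)) (T (∑ x ∈ s, lp.single 2 x (c x)) : Ell2 Γ) := by
  have hs (x : Γ) : (lp.single 2 x (c x) : Ell2 Γ) = c x • lp.single 2 x (1 : ℂ) := by
    rw [← lp.single_smul, smul_eq_mul, mul_one]
  simp only [finiteForm, hs, map_sum, map_smul, sum_inner, inner_sum, inner_smul_left,
    inner_smul_right, ← kernel_eq_inner, Finset.mul_sum]
  rw [Finset.sum_comm]
  refine Finset.sum_congr rfl fun x _ => Finset.sum_congr rfl fun x' _ => by ring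

/-- Finitely supported vectors are dense, so positivity of an operator can be tested on them. -/
theorem isPositive_iff_finiteForm {T : Op Γ} (hT : IsSelfAdjoint T) :
    T.IsPositive ↔ ∀ s c, 0 ≤ (finiteForm s (kernel T) c).re := by
  classical
  constructor
  · intro h s c
    rw [finiteForm_kernel]
    exact h.re_inner_nonneg_right _
  · intro h
    rw [ContinuousLinearMap.isPositive_def']
    refine ⟨hT, fun ψ => ?_⟩
    have hψ : HasSum (fun x => lp.single 2 x (ψ x)) ψ := lp.hasSum_single (by norm_num) ψ
    have hc : Continuous fun v : Ell2 Γ => T.reApplyInnerSelf v := T.reApplyInnerSelf_continuous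
    refine ge_of_tendsto ((hc.tendsto ψ).comp hψ) (Filter.Eventually.of_forall fun s => ?_)
    have := h s ψ
    rw [finiteForm_kernel] at this
    rw [Function.comp_apply, ContinuousLinearMap.reApplyInnerSelf_apply, inner_re_symm]
    exact this

theorem finiteForm_add (s : Finset Γ) (k l : Γ → Γ → ℂ) (c : Γ → ℂ) :
    finiteForm s (fun x x' => k x x' + l x x') c = finiteForm s k c + finiteForm s l c := by
  simp only [finiteForm, mul_add, add_mul, Finset.sum_add_distrib]

theorem finiteForm_kernel_one (s : Finset Γ) (c : Γ → ℂ) :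
    (finiteForm s (kernel 1) c).re = ∑ x ∈ s, ‖c x‖ ^ 2 := by
  classical
  have h : finiteForm s (kernel 1) c = ∑ x ∈ s, ((‖c x‖ ^ 2 : ℝ) : ℂ) := by
    refine Finset.sum_congr rfl fun x hx => ?_
    rw [Finset.sum_eq_single x, kernel_one_self, mul_one, ← normSq_eq_conj_mul_self,
      normSq_eq_norm_sq]
    · intro y _ hy
      rw [kernel_one_of_ne hy.symm]; simp
    · exact fun h => absurd hx h
  rw [h, ← ofReal_sum, ofReal_re]

/-- The **Schur test** for quadratic forms. -/
theorem norm_finiteForm_le {k : Γ → Γ → ℂ} {m : Γ → Γ → ℝ} {C : ℝ} (s : Finset Γ)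
    (hk : ∀ x x', ‖k x x'‖ ≤ m x x') (hm : ∀ x x', m x x' = m x' x)
    (hC : ∀ x', ∑ x ∈ s, m x x' ≤ C) (c : Γ → ℂ) :
    ‖finiteForm s k c‖ ≤ C * ∑ x ∈ s, ‖c x‖ ^ 2 := by
  have h1 : ‖finiteForm s k c‖ ≤ ∑ x ∈ s, ∑ x' ∈ s,
      (m x x' * ‖c x‖ ^ 2 / 2 + m x x' * ‖c x'‖ ^ 2 / 2) := by
    refine (norm_sum_le _ _).trans (Finset.sum_le_sum fun x _ =>
      (norm_sum_le _ _).trans (Finset.sum_le_sum fun x' _ => ?_))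
    rw [norm_mul, norm_mul, RCLike.norm_conj]
    have h0 := (norm_nonneg _).trans (hk x x')
    calc ‖c x‖ * ‖k x x'‖ * ‖c x'‖ = ‖k x x'‖ * (‖c x‖ * ‖c x'‖) := by ring
      _ ≤ m x x' * (‖c x‖ * ‖c x'‖) := by gcongr; exact hk x x'
      _ ≤ m x x' * ((‖c x‖ ^ 2 + ‖c x'‖ ^ 2) / 2) := by
          gcongr
          linarith [two_mul_le_add_sq ‖c x‖ ‖c x'‖]
      _ = _ := by ring
  have h2 : ∑ x ∈ s, ∑ x' ∈ s, m x x' * ‖c x'‖ ^ 2 / 2 ≤ C * (∑ x ∈ s, ‖c x‖ ^ 2) / 2 := by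
    rw [Finset.sum_comm, Finset.mul_sum, Finset.sum_div]
    refine Finset.sum_le_sum fun x' _ => ?_
    rw [← Finset.sum_div, ← Finset.sum_mul]
    gcongr
    exact hC x'
  have h3 : ∑ x ∈ s, ∑ x' ∈ s, m x x' * ‖c x‖ ^ 2 / 2 ≤ C * (∑ x ∈ s, ‖c x‖ ^ 2) / 2 := by
    rw [Finset.sum_comm]
    simpa only [hm] using h2
  simp only [Finset.sum_add_distrib] at h1
  linarith

end Kernel

/-! ### Quadratic inequalities on the spectrum -/

section Spectrum

/-- The continuous functional calculus turns a lower bound of `w l² + u l` on the spectrum into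
positivity of an operator. -/
theorem isSelfAdjoint_and_forall_spectrum_iff {H : Type*} [NormedAddCommGroup H]
    [InnerProductSpace ℂ H] [CompleteSpace H] {T : H →L[ℂ] H} (hT : IsSelfAdjoint T)
    (w u m : ℝ) :
    IsSelfAdjoint (w • (T * T) + u • T - m • 1) ∧
      ((∀ l ∈ spectrum ℝ T, m ≤ w * l ^ 2 + u * l) ↔
        (w • (T * T) + u • T - m • 1).IsPositive) := by
  rw [← ContinuousLinearMap.nonneg_iff_isPositive]
  have h : cfc (fun l : ℝ => w * l ^ 2 + u * l - m) T = w • (T * T) + u • T - m • 1 := by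
    have := cfc_polynomial (R := ℝ)
      (.C w * .X ^ 2 + .C u * .X - .C m : Polynomial ℝ) T hT
    simpa [Algebra.algebraMap_eq_smul_one, pow_two] using this
  rw [← h, cfc_nonneg_iff _ T (by fun_prop) hT]
  simp only [sub_nonneg, iff_self, and_true]
  exact cfc_predicate _ _

variable {Γ : Set Plane}

/-- The operator `w T² + u T - m`. -/
noncomputable def quadratic (T : Op Γ) (w u m : ℝ) : Op Γ := w • (T * T) + u • T - m • 1

theorem forall_spectrum_quadratic_iff {T : Op Γ} (hT : IsSelfAdjoint T) (w u m : ℝ) :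
    (∀ l ∈ spectrum ℝ T, m ≤ w * l ^ 2 + u * l) ↔
      ∀ s c, 0 ≤ (finiteForm s (kernel (quadratic T w u m)) c).re := by
  have h := isSelfAdjoint_and_forall_spectrum_iff hT w u m
  exact h.2.trans (isPositive_iff_finiteForm h.1)

theorem kernel_quadratic (T : Op Γ) (w u m : ℝ) (x x' : Γ) :
    kernel (quadratic T w u m) x x' =
      w * (∑' y, kernel T x y * kernel T y x') + u * kernel T x x' - m * kernel 1 x x' := by
  rw [quadratic, kernel_sub, kernel_add, kernel_smul, kernel_smul, kernel_smul, kernel_mul]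

end Spectrum

/-! ### The Schur test and moments of the kernel -/

section Schur

variable {Γ : Set Plane}

theorem norm_sum_mul_sq_le {k : Γ → Γ → ℂ} {m : Γ → Γ → ℝ} {C : ℝ}
    (hk : ∀ x x', ‖k x x'‖ ≤ m x x') (hm : ∀ x x', m x x' = m x' x)
    (hC : ∀ (s : Finset Γ) x', ∑ x ∈ s, m x x' ≤ C) (t : Finset Γ) (ψ : Γ → ℂ) (x : Γ) :
    ‖∑ y ∈ t, k x y * ψ y‖ ^ 2 ≤ C * ∑ y ∈ t, m x y * ‖ψ y‖ ^ 2 := by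
  have hm0 x x' : 0 ≤ m x x' := (norm_nonneg _).trans (hk x x')
  calc ‖∑ y ∈ t, k x y * ψ y‖ ^ 2 ≤ (∑ y ∈ t, m x y * ‖ψ y‖) ^ 2 := by
        gcongr
        refine (norm_sum_le _ _).trans (Finset.sum_le_sum fun y _ => ?_)
        rw [norm_mul]
        gcongr
        exact hk x y
    _ ≤ (∑ y ∈ t, m x y) * ∑ y ∈ t, m x y * ‖ψ y‖ ^ 2 :=
        Finset.sum_sq_le_sum_mul_sum_of_sq_le_mul _ (fun y _ => hm0 x y)
          (fun y _ => mul_nonneg (hm0 x y) (sq_nonneg _)) fun y _ => le_of_eq (by ring)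
    _ ≤ C * ∑ y ∈ t, m x y * ‖ψ y‖ ^ 2 := by
        gcongr
        · exact Finset.sum_nonneg fun y _ => mul_nonneg (hm0 x y) (sq_nonneg _)
        · simpa only [hm x] using hC t x

open scoped Classical in
/-- The **Schur test**: a kernel with uniformly bounded row and column sums is the kernel of a
bounded operator. -/
theorem exists_kernel_eq {k : Γ → Γ → ℂ} {m : Γ → Γ → ℝ} {C : ℝ} (hC0 : 0 ≤ C)
    (hk : ∀ x x', ‖k x x'‖ ≤ m x x') (hm : ∀ x x', m x x' = m x' x)
    (hC : ∀ (s : Finset Γ) x', ∑ x ∈ s, m x x' ≤ C) :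
    ∃ T : Op Γ, kernel T = k ∧ ‖T‖ ≤ C := by
  have hm0 x x' : 0 ≤ m x x' := (norm_nonneg _).trans (hk x x')
  have hsum (ψ : Ell2 Γ) (x : Γ) : Summable fun y => k x y * ψ y := by
    have h1 : Summable fun y => m x y :=
      summable_of_sum_le (hm0 x) fun s => by simpa only [hm x] using hC s x
    refine .of_norm_bounded (h1.mul_right ‖ψ‖) fun y => ?_
    rw [norm_mul]
    exact mul_le_mul (hk x y) (lp.norm_apply_le_norm (by norm_num) ψ y) (norm_nonneg _) (hm0 x y)
  have hbound (ψ : Ell2 Γ) (s : Finset Γ) :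
      ∑ x ∈ s, ‖∑' y, k x y * ψ y‖ ^ 2 ≤ (C * ‖ψ‖) ^ 2 := by
    have hlim : Filter.Tendsto (fun t : Finset Γ => ∑ x ∈ s, ‖∑ y ∈ t, k x y * ψ y‖ ^ 2)
        Filter.atTop (nhds (∑ x ∈ s, ‖∑' y, k x y * ψ y‖ ^ 2)) :=
      tendsto_finsetSum _ fun x _ => ((hsum ψ x).hasSum.norm).pow 2
    refine le_of_tendsto hlim (Filter.Eventually.of_forall fun t => ?_)
    calc ∑ x ∈ s, ‖∑ y ∈ t, k x y * ψ y‖ ^ 2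
        ≤ ∑ x ∈ s, C * ∑ y ∈ t, m x y * ‖ψ y‖ ^ 2 :=
          Finset.sum_le_sum fun x _ => norm_sum_mul_sq_le hk hm hC t ψ x
      _ = C * ∑ y ∈ t, (∑ x ∈ s, m x y) * ‖ψ y‖ ^ 2 := by
          rw [← Finset.mul_sum, Finset.sum_comm]
          simp only [Finset.sum_mul]
      _ ≤ C * ∑ y ∈ t, C * ‖ψ y‖ ^ 2 := by
          gcongr with y _
          exact hC s y
      _ = C ^ 2 * ∑ y ∈ t, ‖ψ y‖ ^ 2 := by rw [← Finset.mul_sum]; ring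
      _ ≤ C ^ 2 * ‖ψ‖ ^ 2 := by
          gcongr
          have := lp.sum_rpow_le_norm_rpow (p := 2) (by norm_num) ψ t
          simpa using this
      _ = (C * ‖ψ‖) ^ 2 := by ring
  let L : Ell2 Γ →ₗ[ℂ] Ell2 Γ :=
    { toFun := fun ψ => ⟨fun x => ∑' y, k x y * ψ y,
        memℓp_gen' (C := (C * ‖ψ‖) ^ 2) fun s => by simpa using hbound ψ s⟩
      map_add' := fun ψ χ => by
        ext x
        simp only [lp.coeFn_add, Pi.add_apply, mul_add]
        exact (hsum ψ x).tsum_add (hsum χ x)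
      map_smul' := fun c ψ => by
        ext x
        simp only [lp.coeFn_smul, Pi.smul_apply, smul_eq_mul, RingHom.id_apply, ← tsum_mul_left]
        exact tsum_congr fun y => by ring }
  have hL (ψ : Ell2 Γ) : ‖L ψ‖ ≤ C * ‖ψ‖ :=
    lp.norm_le_of_forall_sum_le (by norm_num) (by positivity) fun s => by
      simp only [ENNReal.toReal_ofNat, Real.rpow_ofNat]
      exact hbound ψ s
  refine ⟨L.mkContinuous C hL, ?_, L.mkContinuous_norm_le hC0 hL⟩
  ext x x'
  change ∑' y, k x y * (lp.single 2 x' (1 : ℂ) : Ell2 Γ) y = k x x'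
  rw [tsum_eq_single x' fun y hy => by simp [hy]]
  simp

end Schur

section Moment

/-- Distances in `Γ` are comparable with distances in `ℤ²`, so the lattice sums of
`⟨x - x'⟩^{-2s}`, `s > 1`, are bounded uniformly in `x'`. -/
theorem IsNearIntegerLattice.exists_sum_rpow_le {Γ : Set Plane} (hΓ : IsNearIntegerLattice Γ)
    {r : ℝ} (hr : 1 < r) :
    ∃ C : ℝ, ∀ (s : Finset Γ) (x' : Γ),
      ∑ x ∈ s, (1 + ‖(x : Plane) - x'‖ ^ 2) ^ (-r) ≤ C := by
  classical
  obtain ⟨F, hF, hd⟩ := hΓ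
  let g : (Fin 2 → ℤ) → ℝ := fun n => 3 ^ r * ‖n‖ ^ (-(2 * r)) + if n = 0 then 1 else 0
  have hg0 n : 0 ≤ g n := by positivity
  have hg : Summable g :=
    ((EisensteinSeries.summable_one_div_norm_rpow (by linarith)).mul_left _).add
      (summable_of_hasFiniteSupport ((Set.finite_singleton 0).subset fun n hn => by
        by_contra h
        exact hn (if_neg h)))
  refine ⟨∑' n, g n, fun s x' => ?_⟩
  have hle (x : Γ) : (1 + ‖(x : Plane) - x'‖ ^ 2) ^ (-r) ≤ g (F x - F x') := by
    by_cases h : F x - F x' = 0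
    · rw [sub_eq_zero] at h
      have hx := hF h
      have h3 : (0 : ℝ) ≤ 3 ^ r * ‖F x - F x'‖ ^ (-(2 * r)) := by positivity
      simp [g, hx]
      simpa [hx] using h3
    · have hn : 0 < ‖F x - F x'‖ := norm_pos_iff.mpr h
      have h1 : ‖F x - F x'‖ ≤ ‖(x : Plane) - x'‖ + 1 := by
        have h2 := hd x
        have h3 := hd x'
        set u : Plane := WithLp.toLp 2 fun i => (F x i : ℝ)
        set v : Plane := WithLp.toLp 2 fun i => (F x' i : ℝ)
        have h4 : ‖F x - F x'‖ ≤ ‖u - v‖ := by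
          refine (pi_norm_le_iff_of_nonneg (norm_nonneg _)).mpr fun i => ?_
          refine le_trans (le_of_eq ?_) (PiLp.norm_apply_le (u - v) i)
          simp [u, v, Int.norm_eq_abs]
        have h5 : u - v = (u - x) + ((x : Plane) - x') - (v - x') := by abel
        have h6 := norm_sub_le ((u - x) + ((x : Plane) - x')) (v - x')
        have h7 := norm_add_le (u - x) ((x : Plane) - x')
        rw [← h5] at h6
        linarith
      have h2 : ‖F x - F x'‖ ^ 2 / 3 ≤ 1 + ‖(x : Plane) - x'‖ ^ 2 := by
        nlinarith [norm_nonneg ((x : Plane) - x'), sq_nonneg (‖(x : Plane) - x'‖ - 1)]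
      calc (1 + ‖(x : Plane) - x'‖ ^ 2) ^ (-r) ≤ (‖F x - F x'‖ ^ 2 / 3) ^ (-r) :=
            Real.rpow_le_rpow_of_nonpos (by positivity) h2 (by linarith)
        _ = 3 ^ r * ‖F x - F x'‖ ^ (-(2 * r)) := by
            rw [Real.div_rpow (by positivity) (by norm_num), ← Real.rpow_natCast,
              ← Real.rpow_mul hn.le, Real.rpow_neg (by norm_num : (0 : ℝ) ≤ 3), div_inv_eq_mul,
              mul_comm]
            congr 2
            push_cast
            ring
        _ = g (F x - F x') := by simp [g, h]
  calc ∑ x ∈ s, (1 + ‖(x : Plane) - x'‖ ^ 2) ^ (-r) ≤ ∑ x ∈ s, g (F x - F x') :=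
        Finset.sum_le_sum fun x _ => hle x
    _ = ∑ n ∈ s.image fun x => F x - F x', g n :=
        (Finset.sum_image fun x _ y _ h => hF (sub_left_injective h)).symm
    _ ≤ ∑' n, g n := hg.sum_le_tsum _ fun n _ => hg0 n

variable {Γ : Set Plane}

/-- The majorant `⟨x - x'⟩² |K(x, x')|`. -/
noncomputable def moment (K : Op Γ) (x x' : Γ) : ℝ :=
  (1 + ‖(x : Plane) - x'‖ ^ 2) * ‖kernel K x x'‖

theorem moment_nonneg (K : Op Γ) (x x' : Γ) : 0 ≤ moment K x x' := by
  unfold moment; positivity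

theorem moment_symm {K : Op Γ} (hK : IsSelfAdjoint K) (x x' : Γ) :
    moment K x x' = moment K x' x := by
  rw [moment, moment, (isSelfAdjoint_iff_kernel K).mp hK x x', RCLike.norm_conj, norm_sub_rev]

/-- For `α > 3` the second moments of a kernel in `ℋ^α` are bounded. -/
theorem MemH.exists_sum_moment_le (hΓ : IsNearIntegerLattice Γ) {α : ℝ} (hα : 3 < α) {K : Op Γ}
    (hK : MemH α K) :
    ∃ S : ℝ, 0 ≤ S ∧ ∀ (s : Finset Γ) x', ∑ x ∈ s, moment K x x' ≤ S := by
  obtain ⟨C, hC⟩ := hΓ.exists_sum_rpow_le (r := α - 2) (by linarith)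
  have hN := hK.2
  set N := hNorm α K
  refine ⟨max 0 (((N ^ (2 : ℝ)).toReal + C) / 2), le_max_left _ _, fun s x' => le_max_of_le_right ?_⟩
  have h1 : ∑ x ∈ s, (1 + ‖(x : Plane) - x'‖ ^ 2) ^ α * ‖kernel K x x'‖ ^ 2 ≤
      (N ^ (2 : ℝ)).toReal := by
    rw [← ENNReal.ofReal_le_iff_le_toReal (ENNReal.rpow_lt_top_of_nonneg (by norm_num) hN.ne).ne,
      ENNReal.ofReal_sum_of_nonneg fun _ _ => by positivity]
    have h2 : (∑' x : Γ, ENNReal.ofReal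
        (bracketPow (2 * α) ((x : Plane) - (x' : Plane)) * ‖kernel K x x'‖ ^ 2)) ^ (1 / 2 : ℝ)
          ≤ N := le_iSup (fun x' : Γ => (∑' x : Γ, ENNReal.ofReal
        (bracketPow (2 * α) ((x : Plane) - (x' : Plane)) * ‖kernel K x x'‖ ^ 2)) ^ (1 / 2 : ℝ)) x'
    have h3 := ENNReal.rpow_le_rpow h2 (by norm_num : (0 : ℝ) ≤ 2)
    rw [← ENNReal.rpow_mul] at h3
    norm_num at h3
    refine le_trans ?_ ((ENNReal.sum_le_tsum s).trans (by exact_mod_cast h3))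
    refine Finset.sum_le_sum fun x _ => le_of_eq ?_
    rw [bracketPow, mul_div_cancel_left₀ _ (by norm_num : (2 : ℝ) ≠ 0)]
  have h2 (x : Γ) : moment K x x' ≤ ((1 + ‖(x : Plane) - x'‖ ^ 2) ^ α * ‖kernel K x x'‖ ^ 2 +
      (1 + ‖(x : Plane) - x'‖ ^ 2) ^ (-(α - 2))) / 2 := by
    rw [moment]
    set q := 1 + ‖(x : Plane) - x'‖ ^ 2
    have hq : 0 < q := by positivity
    set k := ‖kernel K x x'‖
    -- the two terms have product `(q k)²`
    have e1 : q ^ α = (q ^ (α / 2)) ^ 2 := by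
      rw [← Real.rpow_natCast, ← Real.rpow_mul hq.le]; congr 1; push_cast; ring
    have e2 : q ^ (-(α - 2)) = (q ^ (1 - α / 2)) ^ 2 := by
      rw [← Real.rpow_natCast, ← Real.rpow_mul hq.le]; congr 1; push_cast; ring
    have e3 : q ^ (α / 2) * q ^ (1 - α / 2) = q := by
      rw [← Real.rpow_add hq]; simp
    have e4 := two_mul_le_add_sq (q ^ (α / 2) * k) (q ^ (1 - α / 2))
    have e5 : q ^ (α / 2) * k * q ^ (1 - α / 2) = q * k := by rw [mul_right_comm, e3]
    rw [e1, e2]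
    nlinarith
  calc ∑ x ∈ s, moment K x x' ≤ _ := Finset.sum_le_sum fun x _ => h2 x
    _ = (∑ x ∈ s, (1 + ‖(x : Plane) - x'‖ ^ 2) ^ α * ‖kernel K x x'‖ ^ 2 +
        ∑ x ∈ s, (1 + ‖(x : Plane) - x'‖ ^ 2) ^ (-(α - 2))) / 2 := by
        rw [← Finset.sum_div, Finset.sum_add_distrib]
    _ ≤ _ := by
        have := hC s x'
        gcongr

end Moment

/-! ### The Gaussian magnetic multiplier -/

section Gaussian

/-- The kernel `e^{i t φ(x, x')} e^{-|t| |x - x'|² / 4}`, up to normalization the integral kernel of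
the projection onto the lowest Landau level of a magnetic field of strength `t`. -/
noncomputable def landau (t : ℝ) (x x' : Plane) : ℂ :=
  exp (I * (t * flux x x' : ℝ) - (|t| * ‖x - x'‖ ^ 2 / 4 : ℝ))

theorem landau_self (t : ℝ) (x : Plane) : landau t x x = 1 := by
  have : flux x x = 0 := by unfold flux; ring
  simp [landau, this]

/-- The Bargmann factorization of the Landau kernel: up to a rank-one factor it is the exponential
of a Gram kernel. For `t < 0` the complex coordinate is conjugated. -/
theorem exists_landau_eq (t : ℝ) : ∃ u g : Plane → ℂ, ∀ x x',
    landau t x x' = conj (g x) * exp ((|t| / 2 : ℝ) * (conj (u x) * u x')) * g x' := by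
  obtain ⟨σ, hσ, ht⟩ : ∃ σ : ℝ, σ ^ 2 = 1 ∧ t = |t| * σ := by
    rcases le_total 0 t with h | h
    · exact ⟨1, by norm_num, by rw [abs_of_nonneg h, mul_one]⟩
    · exact ⟨-1, by norm_num, by rw [abs_of_nonpos h]; ring⟩
  refine ⟨fun x => x 0 - I * σ * x 1, fun x => exp (-(|t| * ‖x‖ ^ 2 / 4) : ℝ), fun x x' => ?_⟩
  have hσ' : (σ : ℂ) ^ 2 = 1 := by exact_mod_cast hσ
  simp only [← ofReal_exp, conj_ofReal]
  simp only [ofReal_exp, ← exp_add, landau]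
  congr 1
  simp only [EuclideanSpace.real_norm_sq_eq, Fin.sum_univ_two, PiLp.sub_apply, flux]
  generalize |t| = τ at *
  subst ht
  push_cast
  simp only [map_sub, map_mul, conj_I, conj_ofReal]
  linear_combination (τ / 2 * x 1 * x' 1 * (I ^ 2) : ℂ) * hσ' + (τ / 2 * x 1 * x' 1 : ℂ) * I_sq

variable {Γ : Set Plane}

/-- Schur multiplication by the Landau kernel preserves positivity: the exponential series expresses
the new quadratic form as a nonnegative combination of values of the old one. -/
theorem finiteForm_mul_landau_nonneg {k : Γ → Γ → ℂ}
    (hk : ∀ s c, 0 ≤ (finiteForm s k c).re) (t : ℝ) (s : Finset Γ) (c : Γ → ℂ) :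
    0 ≤ (finiteForm s (fun x x' => k x x' * landau t x x') c).re := by
  obtain ⟨u, g, hug⟩ := exists_landau_eq t
  have h : HasSum (fun n : ℕ => ((|t| / 2) ^ n / n.factorial : ℝ) *
      finiteForm s k (fun x => u x ^ n * g x * c x))
      (finiteForm s (fun x x' => k x x' * landau t x x') c) := by
    simp only [finiteForm, Finset.mul_sum]
    refine hasSum_sum fun x _ => hasSum_sum fun x' _ => ?_
    have he := NormedSpace.expSeries_div_hasSum_exp
      ((|t| / 2 : ℝ) * (conj (u x) * u x') : ℂ)
    rw [← exp_eq_exp_ℂ] at he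
    have he' := he.mul_left (conj (c x) * k x x' * conj (g x) * g x' * c x')
    convert! he' using 1
    · funext n
      simp only [map_mul, map_pow]
      push_cast
      ring
    · rw [hug]
      ring
  refine (Complex.hasSum_re h).nonneg fun n => ?_
  rw [re_ofReal_mul]
  exact mul_nonneg (by positivity) (hk s _)

theorem norm_exp_I_mul_sub_exp_neg_le (a : ℝ) {v : ℝ} (hv : 0 ≤ v) :
    ‖exp (I * a) - exp (-v : ℝ)‖ ≤ |a| + v := by
  have h1 : ‖exp (I * a) - 1‖ ≤ |a| := Real.norm_exp_I_mul_ofReal_sub_one_le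
  have h2 : ‖1 - exp (-v : ℝ)‖ ≤ v := by
    rw [← ofReal_exp, ← ofReal_one, ← ofReal_sub, norm_real, Real.norm_eq_abs, abs_of_nonneg]
    · linarith [Real.add_one_le_exp (-v)]
    · linarith [Real.exp_le_one_iff.mpr (neg_nonpos.mpr hv)]
  calc _ = ‖(exp (I * a) - 1) + (1 - exp (-v : ℝ))‖ := by congr 1; ring
    _ ≤ _ := (norm_add_le _ _).trans (add_le_add h1 h2)

theorem norm_exp_I (a : ℝ) : ‖exp (I * a)‖ = 1 := by
  rw [mul_comm, norm_exp_ofReal_mul_I]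

/-- The flux through the triangle `x, y, x'` is at most half the product of two side lengths. -/
theorem abs_flux_triangle_le (x y x' : Plane) :
    |flux x y + flux y x' - flux x x'| ≤ ‖x - y‖ * ‖y - x'‖ / 2 := by
  refine abs_le_of_sq_le_sq ?_ (by positivity)
  rw [div_pow, mul_pow]
  simp only [EuclideanSpace.real_norm_sq_eq, Fin.sum_univ_two, PiLp.sub_apply, flux]
  nlinarith [sq_nonneg ((x 0 - y 0) * (y 0 - x' 0) + (x 1 - y 1) * (y 1 - x' 1))]

end Gaussian

/-! ### Comparison of the operators at two field strengths -/

section Comparison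

variable {Γ : Set Plane}

theorem harperKernel_eq (K : Op Γ) (b : ℝ) (x x' : Γ) :
    harperKernel K b x x' = exp (I * (b * flux x x' : ℝ)) * kernel K x x' := by
  rw [harperKernel]; push_cast; ring_nf

theorem norm_harperKernel (K : Op Γ) (b : ℝ) (x x' : Γ) :
    ‖harperKernel K b x x'‖ = ‖kernel K x x'‖ := by
  rw [harperKernel_eq, norm_mul, norm_exp_I, one_mul]

theorem norm_kernel_le_moment (K : Op Γ) (x x' : Γ) : ‖kernel K x x'‖ ≤ moment K x x' := by
  rw [moment]
  nlinarith [norm_nonneg (kernel K x x'), mul_nonneg (sq_nonneg ‖(x : Plane) - x'‖)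
    (norm_nonneg (kernel K x x'))]

theorem norm_harperKernel_sub_le (K : Op Γ) (b b₀ : ℝ) (x x' : Γ) :
    ‖harperKernel K b x x' - harperKernel K b₀ x x' * landau (b - b₀) x x'‖ ≤
      |b - b₀| * moment K x x' := by
  have h : harperKernel K b x x' - harperKernel K b₀ x x' * landau (b - b₀) x x' =
      exp (I * (b * flux x x' : ℝ)) * kernel K x x' *
        (exp (I * (0 : ℝ)) - exp (-(|b - b₀| * ‖(x : Plane) - x'‖ ^ 2 / 4) : ℝ)) := by
    have e : exp (I * (b₀ * flux x x' : ℝ)) * landau (b - b₀) x x' =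
        exp (I * (b * flux x x' : ℝ)) *
          exp (-(|b - b₀| * ‖(x : Plane) - x'‖ ^ 2 / 4) : ℝ) := by
      rw [landau, ← exp_add, ← exp_add]
      congr 1
      push_cast
      ring
    rw [harperKernel_eq, harperKernel_eq, mul_right_comm, e]
    simp only [ofReal_zero, mul_zero, exp_zero]
    ring
  rw [h, norm_mul, norm_mul, norm_exp_I, one_mul]
  have h1 := norm_exp_I_mul_sub_exp_neg_le 0
    (v := |b - b₀| * ‖(x : Plane) - x'‖ ^ 2 / 4) (by positivity)
  rw [abs_zero, zero_add] at h1
  calc _ ≤ ‖kernel K x x'‖ * (|b - b₀| * ‖(x : Plane) - x'‖ ^ 2 / 4) := by gcongr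
    _ ≤ |b - b₀| * moment K x x' := by
      rw [moment]
      have : 0 ≤ |b - b₀| * ‖kernel K x x'‖ := by positivity
      nlinarith [mul_nonneg this (sq_nonneg ‖(x : Plane) - x'‖)]

theorem norm_harperKernel_mul_sub_le (K : Op Γ) (b b₀ : ℝ) (x y x' : Γ) :
    ‖harperKernel K b x y * harperKernel K b y x' -
        harperKernel K b₀ x y * harperKernel K b₀ y x' * landau (b - b₀) x x'‖ ≤
      |b - b₀| * (moment K x y * moment K y x') := by
  set v := |b - b₀| * ‖(x : Plane) - x'‖ ^ 2 / 4
  set a := (b - b₀) * (flux x y + flux y x' - flux x x')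
  have h : harperKernel K b x y * harperKernel K b y x' -
        harperKernel K b₀ x y * harperKernel K b₀ y x' * landau (b - b₀) x x' =
      exp (I * (b₀ * (flux x y + flux y x') + (b - b₀) * flux x x' : ℝ)) *
        (kernel K x y * kernel K y x') * (exp (I * a) - exp (-v : ℝ)) := by
    have e1 : exp (I * (b * flux x y : ℝ)) * exp (I * (b * flux y x' : ℝ)) =
        exp (I * (b₀ * (flux x y + flux y x') + (b - b₀) * flux x x' : ℝ)) * exp (I * a) := by
      rw [← exp_add, ← exp_add]
      congr 1
      push_cast [a]
      ring
    have e2 : exp (I * (b₀ * flux x y : ℝ)) * exp (I * (b₀ * flux y x' : ℝ)) *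
          landau (b - b₀) x x' =
        exp (I * (b₀ * (flux x y + flux y x') + (b - b₀) * flux x x' : ℝ)) *
          exp (-v : ℝ) := by
      rw [landau, ← exp_add, ← exp_add, ← exp_add]
      congr 1
      push_cast [v]
      ring
    simp only [harperKernel_eq]
    linear_combination (kernel K x y * kernel K y x') * e1 - (kernel K x y * kernel K y x') * e2
  have ha : |a| ≤ |b - b₀| * (‖(x : Plane) - y‖ * ‖(y : Plane) - x'‖ / 2) := by
    rw [abs_mul]
    gcongr
    exact abs_flux_triangle_le _ _ _
  have hv : v ≤ |b - b₀| * ((‖(x : Plane) - y‖ + ‖(y : Plane) - x'‖) ^ 2 / 4) := by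
    simp only [v, mul_div_assoc]
    gcongr
    simpa using norm_add_le ((x : Plane) - y) ((y : Plane) - x')
  have h1 : |a| + v ≤ |b - b₀| * ((1 + ‖(x : Plane) - y‖ ^ 2) * (1 + ‖(y : Plane) - x'‖ ^ 2)) := by
    refine (add_le_add ha hv).trans ?_
    rw [← mul_add]
    gcongr
    nlinarith [sq_nonneg (‖(x : Plane) - y‖ - ‖(y : Plane) - x'‖),
      sq_nonneg (‖(x : Plane) - y‖ * ‖(y : Plane) - x'‖)]
  rw [h, norm_mul, norm_mul, norm_exp_I, one_mul]
  calc _ ≤ ‖kernel K x y * kernel K y x'‖ * (|b - b₀| *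
        ((1 + ‖(x : Plane) - y‖ ^ 2) * (1 + ‖(y : Plane) - x'‖ ^ 2))) := by
        gcongr
        exact (norm_exp_I_mul_sub_exp_neg_le a (by positivity)).trans h1
    _ = _ := by rw [moment, moment, norm_mul]; ring

/-- The majorant of the kernel of `K²`. -/
noncomputable def momentSq (K : Op Γ) (x x' : Γ) : ℝ := ∑' y, moment K x y * moment K y x'

variable {K : Op Γ} {S : ℝ}

theorem momentSq_symm (hK : IsSelfAdjoint K) (x x' : Γ) : momentSq K x x' = momentSq K x' x :=
  tsum_congr fun y => by rw [mul_comm, moment_symm hK y, moment_symm hK x y]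

theorem summable_moment_mul (hS : ∀ (s : Finset Γ) x', ∑ x ∈ s, moment K x x' ≤ S) (x x' : Γ) :
    Summable fun y => moment K x y * moment K y x' := by
  have h : Summable fun y => moment K y x' :=
    summable_of_sum_le (fun y => moment_nonneg K y x') fun s => hS s x'
  refine (h.mul_left S).of_nonneg_of_le
    (fun y => mul_nonneg (moment_nonneg _ _ _) (moment_nonneg _ _ _)) fun y => ?_
  gcongr
  · exact moment_nonneg _ _ _
  · simpa using hS {x} y

theorem sum_momentSq_le (hS0 : 0 ≤ S) (hS : ∀ (s : Finset Γ) x', ∑ x ∈ s, moment K x x' ≤ S)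
    (s : Finset Γ) (x' : Γ) : ∑ x ∈ s, momentSq K x x' ≤ S ^ 2 := by
  have h : Summable fun y => moment K y x' :=
    summable_of_sum_le (fun y => moment_nonneg K y x') fun s => hS s x'
  have h1 : ∑' y, moment K y x' ≤ S := h.tsum_le_of_sum_le fun s => hS s x'
  simp only [momentSq]
  rw [← Summable.tsum_finsetSum fun x _ => summable_moment_mul hS x x']
  calc _ ≤ ∑' y, S * moment K y x' := by
        refine Summable.tsum_le_tsum (fun y => ?_)
          (summable_sum fun x _ => summable_moment_mul hS x x') (h.mul_left S)
        rw [← Finset.sum_mul]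
        have := moment_nonneg K y x'
        gcongr
        exact hS s y
    _ = S * ∑' y, moment K y x' := tsum_mul_left
    _ ≤ S ^ 2 := by rw [pow_two]; gcongr

/-- The kernel of `w K_b² + u K_b - m` differs from the Schur product of the kernel of
`w K_{b₀}² + u K_{b₀} - m` with the Landau kernel by `O(b - b₀)`. -/
theorem norm_kernel_quadratic_sub_le
    (hS : ∀ (s : Finset Γ) x', ∑ x ∈ s, moment K x x' ≤ S) {b b₀ : ℝ} {T T₀ : Op Γ}
    (hT : kernel T = harperKernel K b) (hT₀ : kernel T₀ = harperKernel K b₀)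
    (w u m : ℝ) (x x' : Γ) :
    ‖kernel (quadratic T w u m) x x' -
        kernel (quadratic T₀ w u m) x x' * landau (b - b₀) x x'‖ ≤
      |b - b₀| * (|w| * momentSq K x x' + |u| * moment K x x') := by
  have hs (b : ℝ) : Summable fun y => harperKernel K b x y * harperKernel K b y x' := by
    refine .of_norm_bounded (summable_moment_mul hS x x') fun y => ?_
    rw [norm_mul, norm_harperKernel, norm_harperKernel]
    exact mul_le_mul (norm_kernel_le_moment ..) (norm_kernel_le_moment ..) (norm_nonneg _)
      (moment_nonneg ..)
  have hsq : ‖(∑' y, harperKernel K b x y * harperKernel K b y x') -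
      (∑' y, harperKernel K b₀ x y * harperKernel K b₀ y x') * landau (b - b₀) x x'‖ ≤
        |b - b₀| * momentSq K x x' := by
    rw [← tsum_mul_right, ← (hs b).tsum_sub ((hs b₀).mul_right _), momentSq, ← tsum_mul_left]
    exact tsum_of_norm_bounded ((summable_moment_mul hS x x').mul_left _).hasSum
      fun y => norm_harperKernel_mul_sub_le K b b₀ x y x'
  have hone : kernel (1 : Op Γ) x x' * landau (b - b₀) x x' = kernel 1 x x' := by
    rcases eq_or_ne x x' with rfl | h
    · rw [landau_self, mul_one]
    · rw [kernel_one_of_ne h, zero_mul]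
  rw [kernel_quadratic, kernel_quadratic, hT, hT₀]
  have e (p q r p₀ q₀ g : ℂ) (hr : r * g = r) : (w * p + u * q - m * r) -
      (w * p₀ + u * q₀ - m * r) * g = w * (p - p₀ * g) + u * (q - q₀ * g) := by
    linear_combination m * hr
  rw [e _ _ _ _ _ _ hone]
  refine (norm_add_le _ _).trans ?_
  rw [norm_mul, norm_mul, norm_real, norm_real, Real.norm_eq_abs, Real.norm_eq_abs]
  calc _ ≤ |w| * (|b - b₀| * momentSq K x x') + |u| * (|b - b₀| * moment K x x') := by
        gcongr
        exact norm_harperKernel_sub_le K b b₀ x x'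
    _ = _ := by ring

/-- The central estimate: a lower bound of a quadratic polynomial on the spectrum of `K_{b₀}`
persists on the spectrum of `K_b` up to `O(b - b₀)`. -/
theorem spectrum_quadratic_lower_bound (hK : IsSelfAdjoint K) (hS0 : 0 ≤ S)
    (hS : ∀ (s : Finset Γ) x', ∑ x ∈ s, moment K x x' ≤ S) {b b₀ : ℝ} {T T₀ : Op Γ}
    (hTsa : IsSelfAdjoint T) (hT₀sa : IsSelfAdjoint T₀)
    (hT : kernel T = harperKernel K b) (hT₀ : kernel T₀ = harperKernel K b₀) {w u m : ℝ}
    (h : ∀ l ∈ spectrum ℝ T₀, m ≤ w * l ^ 2 + u * l) :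
    ∀ l ∈ spectrum ℝ T, m - (S ^ 2 + S) * (|w| + |u|) * |b - b₀| ≤ w * l ^ 2 + u * l := by
  rw [forall_spectrum_quadratic_iff hT₀sa] at h
  rw [forall_spectrum_quadratic_iff hTsa]
  intro s c
  set E := (S ^ 2 + S) * (|w| + |u|) * |b - b₀|
  have hpos := finiteForm_mul_landau_nonneg h (b - b₀) s c
  set D : Γ → Γ → ℂ := fun x x' => kernel (quadratic T w u m) x x' -
    kernel (quadratic T₀ w u m) x x' * landau (b - b₀) x x'
  have hD : ‖finiteForm s D c‖ ≤ E * ∑ x ∈ s, ‖c x‖ ^ 2 := by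
    refine norm_finiteForm_le s (norm_kernel_quadratic_sub_le hS hT hT₀ w u m) (fun x x' => ?_)
      (fun x' => ?_) c
    · rw [momentSq_symm hK, moment_symm hK]
    · rw [← Finset.mul_sum, Finset.sum_add_distrib, ← Finset.mul_sum, ← Finset.mul_sum]
      have h1 := sum_momentSq_le hS0 hS s x'
      have h2 := hS s x'
      calc _ ≤ |b - b₀| * (|w| * S ^ 2 + |u| * S) := by gcongr
        _ ≤ |b - b₀| * ((S ^ 2 + S) * (|w| + |u|)) := by
          gcongr
          nlinarith [mul_nonneg (abs_nonneg w) hS0, mul_nonneg (abs_nonneg u) (sq_nonneg S)]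
        _ = E := by ring
  have hk : kernel (quadratic T w u (m - E)) = fun x x' =>
      (kernel (quadratic T₀ w u m) x x' * landau (b - b₀) x x' + D x x') +
        kernel (E • (1 : Op Γ)) x x' := by
    funext x x'
    simp only [D, kernel_quadratic, kernel_smul]
    push_cast
    ring
  have hone : (finiteForm s (kernel (E • (1 : Op Γ))) c).re = E * ∑ x ∈ s, ‖c x‖ ^ 2 := by
    rw [← finiteForm_kernel_one, ← re_ofReal_mul]
    congr 1
    simp only [finiteForm, kernel_smul, Finset.mul_sum]
    refine Finset.sum_congr rfl fun x _ => Finset.sum_congr rfl fun x' _ => by ring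
  rw [hk, finiteForm_add, finiteForm_add, add_re, add_re, hone]
  have := (abs_le.mp ((abs_re_le_norm _).trans hD)).1
  linarith

/-- The kernel `e^{i b φ} K` is the kernel of a bounded self-adjoint operator. -/
theorem isSelfAdjoint_harper_and_kernel (hK : IsSelfAdjoint K) (hS0 : 0 ≤ S)
    (hS : ∀ (s : Finset Γ) x', ∑ x ∈ s, moment K x x' ≤ S) (b : ℝ) :
    IsSelfAdjoint (harper K b) ∧ kernel (harper K b) = harperKernel K b ∧
      ‖harper K b‖ ≤ S := by
  obtain ⟨T, hT, hTS⟩ := exists_kernel_eq hS0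
    (fun x x' => (norm_harperKernel K b x x').trans_le (norm_kernel_le_moment K x x'))
    (moment_symm hK) hS
  have hk : kernel (harper K b) = harperKernel K b := kernel_opOfKernel ⟨T, hT⟩
  refine ⟨(isSelfAdjoint_iff_kernel _).mpr fun x x' => ?_, hk,
    (kernel_injective (hk.trans hT.symm)).symm ▸ hTS⟩
  have hf : flux x' x = -flux x x' := by unfold flux; ring
  rw [hk, harperKernel_eq, harperKernel_eq, map_mul, ← exp_conj, map_mul, conj_I, conj_ofReal, hf,
    ← (isSelfAdjoint_iff_kernel K).mp hK]
  congr 2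
  push_cast
  ring

end Comparison

/-! ### Families of compact sets with stable quadratic bounds -/

/-- A family of nonempty compact subsets of `[-M, M]` for which a lower bound of a quadratic
polynomial at one parameter persists at any other parameter, up to an error that is linear in the
coefficients and in the distance of the parameters. -/
structure IsQuadraticallyStable (σ : ℝ → Set ℝ) (C M : ℝ) : Prop where
  isCompact : ∀ b, IsCompact (σ b)
  nonempty : ∀ b, (σ b).Nonempty
  const_nonneg : 0 ≤ C
  abs_le_bound : ∀ b, ∀ l ∈ σ b, |l| ≤ M
  lower_bound : ∀ b₀ w u m : ℝ, (∀ l ∈ σ b₀, m ≤ w * l ^ 2 + u * l) →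
    ∀ b, ∀ l ∈ σ b, m - C * (|w| + |u|) * |b - b₀| ≤ w * l ^ 2 + u * l

namespace IsQuadraticallyStable

variable {σ : ℝ → Set ℝ} {C M : ℝ}

theorem bound_nonneg (h : IsQuadraticallyStable σ C M) : 0 ≤ M := by
  obtain ⟨l, hl⟩ := h.nonempty 0
  exact (abs_nonneg l).trans (h.abs_le_bound 0 l hl)

theorem lipschitzWith_sSup (h : IsQuadraticallyStable σ C M) :
    LipschitzWith C.toNNReal fun b => sSup (σ b) := by
  refine LipschitzWith.of_le_add_mul _ fun b b₀ => csSup_le (h.nonempty b) fun l hl => ?_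
  have := h.lower_bound b₀ 0 (-1) (-sSup (σ b₀)) (fun l hl => by
    linarith [le_csSup (h.isCompact b₀).bddAbove hl]) b l hl
  rw [Real.dist_eq, Real.coe_toNNReal _ h.const_nonneg]
  norm_num at this
  linarith

theorem lipschitzWith_sInf (h : IsQuadraticallyStable σ C M) :
    LipschitzWith C.toNNReal fun b => sInf (σ b) := by
  refine LipschitzWith.of_le_add_mul _ fun b₀ b => ?_
  rw [← sub_le_iff_le_add]
  refine le_csInf (h.nonempty b) fun l hl => ?_
  have := h.lower_bound b₀ 0 1 (sInf (σ b₀)) (fun l hl => by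
    linarith [csInf_le (h.isCompact b₀).bddBelow hl]) b l hl
  rw [dist_comm, Real.dist_eq, Real.coe_toNNReal _ h.const_nonneg]
  norm_num at this
  linarith

theorem sq_norm_sub_ofReal (z : ℂ) (l : ℝ) : ‖z - l‖ ^ 2 = (l ^ 2 - 2 * z.re * l) + ‖z‖ ^ 2 := by
  rw [Complex.sq_norm, Complex.sq_norm, Complex.normSq_apply, Complex.normSq_apply]
  simp only [Complex.sub_re, Complex.sub_im, Complex.ofReal_re, Complex.ofReal_im]
  ring

/-- The complement of `σ b` is stable, uniformly in the complex point `z`. For `z` far away there is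
nothing to show since `σ b` is bounded; elsewhere `|z - l|²` is a quadratic polynomial in `l`
with bounded coefficients. -/
theorem exists_le_norm_sub (h : IsQuadraticallyStable σ C M) (b₀ : ℝ) {ε : ℝ} (hε : 0 < ε) :
    ∃ δ > (0 : ℝ), ∃ η > (0 : ℝ), ∀ z : ℂ, (∀ l ∈ σ b₀, ε ≤ ‖z - l‖) →
      ∀ b, |b - b₀| < δ → ∀ l ∈ σ b, η ≤ ‖z - l‖ := by
  have hM := h.bound_nonneg
  have hC := h.const_nonneg
  set B := C * (1 + 2 * (M + ε))
  have hB : 0 ≤ B := by positivity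
  refine ⟨ε ^ 2 / (2 * (B + 1)), by positivity, ε / 2, by positivity, fun z hz b hb l hl => ?_⟩
  rcases lt_or_ge (M + ε) |z.re| with hx | hx
  · have h1 := h.abs_le_bound b l hl
    have h2 := Complex.abs_re_le_norm (z - l)
    have h3 := abs_sub_abs_le_abs_sub z.re l
    rw [Complex.sub_re, Complex.ofReal_re] at h2
    linarith
  · have h1 := h.lower_bound b₀ 1 (-(2 * z.re)) (ε ^ 2 - ‖z‖ ^ 2) (fun l hl => by
      have h2 := pow_le_pow_left₀ hε.le (hz l hl) 2
      rw [sq_norm_sub_ofReal] at h2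
      linarith) b l hl
    have h3 : C * (|1| + |-(2 * z.re)|) * |b - b₀| ≤ B * (ε ^ 2 / (2 * (B + 1))) := by
      rw [abs_neg, abs_mul, abs_one, abs_two]
      simp only [B]
      gcongr
    have h4 : B * (ε ^ 2 / (2 * (B + 1))) ≤ ε ^ 2 / 2 := by
      rw [mul_div_assoc', div_le_div_iff₀ (by positivity) two_pos]
      nlinarith [sq_nonneg ε]
    refine le_of_sq_le_sq ?_ (norm_nonneg _)
    rw [sq_norm_sub_ofReal, div_pow]
    have h5 := h3.trans h4
    generalize C * (|1| + |-(2 * z.re)|) * |b - b₀| = E at h1 h5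
    linarith [sq_nonneg ε]

/-- A continuous curve in the complement keeps a positive distance from `σ b` on a compact
interval. -/
theorem exists_le_abs_sub (h : IsQuadraticallyStable σ C M) {p q : ℝ} {γ : ℝ → ℝ}
    (hγ : ContinuousOn γ (Set.Icc p q)) (hσ : ∀ b ∈ Set.Icc p q, γ b ∉ σ b) :
    ∃ d > (0 : ℝ), ∀ b ∈ Set.Icc p q, ∀ l ∈ σ b, d ≤ |γ b - l| := by
  refine isCompact_Icc.induction_on (p := fun s => ∃ d > (0 : ℝ), ∀ b ∈ s, ∀ l ∈ σ b, d ≤ |γ b - l|)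
    ⟨1, one_pos, by simp⟩ (fun s t hst ⟨d, hd, H⟩ => ⟨d, hd, fun b hb => H b (hst hb)⟩)
    (fun s t ⟨d, hd, H⟩ ⟨d', hd', H'⟩ => ⟨min d d', lt_min hd hd', ?_⟩) fun b₁ hb₁ => ?_
  · rintro b (hb | hb) l hl
    · exact (min_le_left _ _).trans (H b hb l hl)
    · exact (min_le_right _ _).trans (H' b hb l hl)
  · have hcl := (h.isCompact b₁).isClosed
    have hε := (hcl.notMem_iff_infDist_pos (h.nonempty b₁)).mp (hσ b₁ hb₁)
    obtain ⟨δ, hδ, η, hη, H⟩ := h.exists_le_norm_sub b₁ hε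
    have H₁ := H (γ b₁) fun l hl => by
      rw [← Complex.ofReal_sub, Complex.norm_real]
      exact Metric.infDist_le_dist_of_mem hl
    have e1 : ∀ᶠ b in nhdsWithin b₁ (Set.Icc p q), |γ b - γ b₁| < η / 2 :=
      (hγ b₁ hb₁).eventually (Metric.ball_mem_nhds _ (half_pos hη))
    have e2 : ∀ᶠ b in nhdsWithin b₁ (Set.Icc p q), |b - b₁| < δ :=
      nhdsWithin_le_nhds (Metric.ball_mem_nhds _ hδ)
    refine ⟨_, e1.and e2, η / 2, half_pos hη, fun b ⟨hb1, hb2⟩ l hl => ?_⟩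
    have h1 := H₁ b hb2 l hl
    rw [← Complex.ofReal_sub, Complex.norm_real, Real.norm_eq_abs] at h1
    have h2 := abs_sub_le (γ b₁) (γ b) l
    rw [abs_sub_comm (γ b₁) (γ b)] at h2
    linarith

/-- A gap persists up to an error that is linear in `b - b₀` and inversely proportional to the
distance `d` to the opposite edge, since `(l - a) (l - c) ≥ 0` on `σ b₀`. -/
theorem edge_le (h : IsQuadraticallyStable σ C M) {b₀ a c : ℝ} (hgap : IsGap (σ b₀) a c)
    {d : ℝ} (hd : 0 < d) {b l : ℝ} (hl : l ∈ σ b) :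
    (l + d ≤ c → l ≤ a + C * (1 + 2 * M) / d * |b - b₀|) ∧
      (a + d ≤ l → c ≤ l + C * (1 + 2 * M) / d * |b - b₀|) := by
  obtain ⟨hac, ha, hc, hdis⟩ := hgap
  have h1 := h.lower_bound b₀ 1 (-(a + c)) (-(a * c)) (fun l hl => by
    rcases le_or_gt l a with h1 | h1
    · nlinarith
    · rcases le_or_gt c l with h2 | h2
      · nlinarith
      · exact absurd hl (Set.disjoint_left.mp hdis ⟨h1, h2⟩)) b l hl
  have h2 : C * (|1| + |-(a + c)|) * |b - b₀| ≤ C * (1 + 2 * M) * |b - b₀| := by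
    have hC := h.const_nonneg
    rw [abs_neg, abs_one]
    gcongr
    linarith [abs_add_le a c, h.abs_le_bound b₀ a ha, h.abs_le_bound b₀ c hc]
  have h0 : 0 ≤ C * (1 + 2 * M) * |b - b₀| := by
    have hC := h.const_nonneg
    have hM := h.bound_nonneg
    positivity
  set E := C * (1 + 2 * M) * |b - b₀| with hE
  have h3 : C * (1 + 2 * M) / d * |b - b₀| = E / d := by rw [hE]; ring
  have h4 : (l - a) * (c - l) ≤ E := by linarith
  rw [h3]
  constructor
  · intro hlc
    rw [← sub_le_iff_le_add', le_div_iff₀ hd]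
    rcases le_or_gt l a with h5 | h5
    · nlinarith
    · nlinarith
  · intro hla
    rw [← sub_le_iff_le_add', le_div_iff₀ hd]
    rcases le_or_gt c l with h5 | h5
    · nlinarith
    · nlinarith

/-- The extremes of `σ b` stay on their sides of the curve `γ`, by the intermediate value theorem. -/
theorem sInf_lt_and_lt_sSup (h : IsQuadraticallyStable σ C M) {p q b₀ : ℝ}
    (hb₀ : b₀ ∈ Set.Icc p q) {γ : ℝ → ℝ} (hγ : ContinuousOn γ (Set.Icc p q))
    (hσ : ∀ b ∈ Set.Icc p q, γ b ∉ σ b) (h₀ : sInf (σ b₀) < γ b₀ ∧ γ b₀ < sSup (σ b₀))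
    {b : ℝ} (hb : b ∈ Set.Icc p q) : sInf (σ b) < γ b ∧ γ b < sSup (σ b) := by
  constructor
  · by_contra! hlt
    obtain ⟨b₂, hb₂, he⟩ := isPreconnected_Icc.intermediate_value hb₀ hb
      (h.lipschitzWith_sInf.continuous.continuousOn.sub hγ)
      ⟨sub_nonpos.mpr h₀.1.le, sub_nonneg.mpr hlt⟩
    exact hσ b₂ hb₂ (sub_eq_zero.mp he ▸ (h.isCompact b₂).sInf_mem (h.nonempty b₂))
  · by_contra! hlt
    obtain ⟨b₂, hb₂, he⟩ := isPreconnected_Icc.intermediate_value hb₀ hb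
      (hγ.sub h.lipschitzWith_sSup.continuous.continuousOn)
      ⟨sub_nonpos.mpr h₀.2.le, sub_nonneg.mpr hlt⟩
    exact hσ b₂ hb₂ ((sub_eq_zero.mp he).symm ▸ (h.isCompact b₂).sSup_mem (h.nonempty b₂))

/-- The edges are the points of `σ b` nearest to `γ b` from below and from above. -/
theorem exists_lipschitz_edges (h : IsQuadraticallyStable σ C M) {p q b₀ : ℝ}
    (hb₀ : b₀ ∈ Set.Icc p q) {a c : ℝ} (hgap : IsGap (σ b₀) a c) {γ : ℝ → ℝ}
    (hγ : ContinuousOn γ (Set.Icc p q)) (hγ₀ : γ b₀ ∈ Set.Ioo a c)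
    (hσ : ∀ b ∈ Set.Icc p q, γ b ∉ σ b) :
    ∃ eMinus ePlus : ℝ → ℝ, eMinus b₀ = a ∧ ePlus b₀ = c ∧
      (∀ b ∈ Set.Icc p q, IsGap (σ b) (eMinus b) (ePlus b) ∧
        γ b ∈ Set.Ioo (eMinus b) (ePlus b)) ∧
      ∃ L : ℝ≥0, LipschitzOnWith L eMinus (Set.Icc p q) ∧
        LipschitzOnWith L ePlus (Set.Icc p q) := by
  set e : ℝ → ℝ := fun b => sSup (σ b ∩ Set.Iic (γ b))
  set f : ℝ → ℝ := fun b => sInf (σ b ∩ Set.Ici (γ b))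
  have hside : ∀ b ∈ Set.Icc p q, sInf (σ b) < γ b ∧ γ b < sSup (σ b) := fun b hb =>
    h.sInf_lt_and_lt_sSup hb₀ hγ hσ
      ⟨(csInf_le (h.isCompact b₀).bddBelow hgap.2.1).trans_lt hγ₀.1,
        hγ₀.2.trans_le (le_csSup (h.isCompact b₀).bddAbove hgap.2.2.1)⟩ hb
  have hce b : IsCompact (σ b ∩ Set.Iic (γ b)) := (h.isCompact b).inter_right isClosed_Iic
  have hcf b : IsCompact (σ b ∩ Set.Ici (γ b)) := (h.isCompact b).inter_right isClosed_Ici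
  have hemem : ∀ b ∈ Set.Icc p q, e b ∈ σ b ∩ Set.Iic (γ b) := fun b hb =>
    (hce b).sSup_mem ⟨_, (h.isCompact b).sInf_mem (h.nonempty b), (hside b hb).1.le⟩
  have hfmem : ∀ b ∈ Set.Icc p q, f b ∈ σ b ∩ Set.Ici (γ b) := fun b hb =>
    (hcf b).sInf_mem ⟨_, (h.isCompact b).sSup_mem (h.nonempty b), (hside b hb).2.le⟩
  have hle_e {b l} (hl : l ∈ σ b) (hlt : l ≤ γ b) : l ≤ e b :=
    le_csSup (hce b).bddAbove ⟨hl, hlt⟩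
  have hf_le {b l} (hl : l ∈ σ b) (hlt : γ b ≤ l) : f b ≤ l :=
    csInf_le (hcf b).bddBelow ⟨hl, hlt⟩
  have hin : ∀ b ∈ Set.Icc p q, γ b ∈ Set.Ioo (e b) (f b) := fun b hb =>
    ⟨lt_of_le_of_ne (hemem b hb).2 fun heq => hσ b hb (heq ▸ (hemem b hb).1),
      lt_of_le_of_ne (hfmem b hb).2 fun heq => hσ b hb (heq ▸ (hfmem b hb).1)⟩
  have hgaps : ∀ b ∈ Set.Icc p q, IsGap (σ b) (e b) (f b) := fun b hb =>
    ⟨(hin b hb).1.trans (hin b hb).2, (hemem b hb).1, (hfmem b hb).1,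
      Set.disjoint_left.mpr fun l hl hls => by
        rcases le_total l (γ b) with hlt | hlt
        · exact hl.1.not_ge (hle_e hls hlt)
        · exact hl.2.not_ge (hf_le hls hlt)⟩
  have hnot {l} (hl : l ∈ σ b₀) : ¬ (a < l ∧ l < c) := fun hlt =>
    Set.disjoint_left.mp hgap.2.2.2 hlt hl
  refine ⟨e, f, ?_, ?_, fun b hb => ⟨hgaps b hb, hin b hb⟩, ?_⟩
  · refine le_antisymm ?_ (hle_e hgap.2.1 hγ₀.1.le)
    by_contra! hlt
    exact hnot (hemem b₀ hb₀).1 ⟨hlt, (hemem b₀ hb₀).2.trans_lt hγ₀.2⟩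
  · refine le_antisymm (hf_le hgap.2.2.1 hγ₀.2.le) ?_
    by_contra! hlt
    exact hnot (hfmem b₀ hb₀).1 ⟨hγ₀.1.trans_le (hfmem b₀ hb₀).2, hlt⟩
  obtain ⟨d, hd, hdist⟩ := h.exists_le_abs_sub hγ hσ
  obtain ⟨δ, hδ, hδγ⟩ := Metric.uniformContinuousOn_iff.mp
    (isCompact_Icc.uniformContinuousOn_of_continuous hγ) d hd
  have hM := h.bound_nonneg
  have hC := h.const_nonneg
  have hed : ∀ b ∈ Set.Icc p q, e b + d ≤ γ b := fun b hb => by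
    have := hdist b hb _ (hemem b hb).1
    rw [abs_of_pos (sub_pos.mpr (hin b hb).1)] at this
    linarith
  have hfd : ∀ b ∈ Set.Icc p q, γ b + d ≤ f b := fun b hb => by
    have := hdist b hb _ (hfmem b hb).1
    rw [abs_of_neg (sub_neg.mpr (hin b hb).2)] at this
    linarith
  -- Nearby parameters are compared by persistence of the gap, distant ones by boundedness.
  have hA : 0 ≤ C * (1 + 2 * M) / d := by positivity
  have hB : 0 ≤ 2 * M / δ := by positivity
  have hlip : ∀ b ∈ Set.Icc p q, ∀ b' ∈ Set.Icc p q,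
      e b ≤ e b' + (C * (1 + 2 * M) / d + 2 * M / δ) * dist b b' ∧
      f b' ≤ f b + (C * (1 + 2 * M) / d + 2 * M / δ) * dist b b' := by
    intro b hb b' hb'
    rcases lt_or_ge (dist b b') δ with hlt | hge
    · have hγd := hδγ b hb b' hb' hlt
      rw [Real.dist_eq, abs_lt] at hγd
      have h1 := (h.edge_le (hgaps b' hb') hd (hemem b hb).1).1
        (by linarith [hed b hb, hfd b' hb'])
      have h2 := (h.edge_le (hgaps b' hb') hd (hfmem b hb).1).2
        (by linarith [hed b' hb', hfd b hb])
      rw [← Real.dist_eq] at h1 h2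
      have h3 : 0 ≤ 2 * M / δ * dist b b' := by positivity
      constructor <;> linarith
    · have h1 : 2 * M ≤ 2 * M / δ * dist b b' := by
        rw [div_mul_eq_mul_div, le_div_iff₀ hδ]
        gcongr
      have h3 : 0 ≤ C * (1 + 2 * M) / d * dist b b' := by positivity
      have e1 := abs_le.mp (h.abs_le_bound b _ (hemem b hb).1)
      have e2 := abs_le.mp (h.abs_le_bound b' _ (hemem b' hb').1)
      have f1 := abs_le.mp (h.abs_le_bound b _ (hfmem b hb).1)
      have f2 := abs_le.mp (h.abs_le_bound b' _ (hfmem b' hb').1)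
      constructor <;> linarith [e1.1, e1.2, e2.1, e2.2, f1.1, f1.2, f2.1, f2.2]
  refine ⟨⟨_, add_nonneg hA hB⟩, LipschitzOnWith.of_le_add_mul _ fun b hb b' hb' => ?_,
    LipschitzOnWith.of_le_add_mul _ fun b hb b' hb' => ?_⟩
  · exact (hlip b hb b' hb').1
  · rw [dist_comm]
    exact (hlip b' hb' b hb).2

end IsQuadraticallyStable

/-! ### The spectra of Harper-like operators -/

variable {Γ : Set Plane}

theorem nontrivial_op (hne : Γ.Nonempty) : Nontrivial (Op Γ) := by
  obtain ⟨x, hx⟩ := hne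
  refine ⟨0, 1, fun h => ?_⟩
  have h1 := kernel_one_self (⟨x, hx⟩ : Γ)
  rw [← h] at h1
  simp [kernel] at h1

theorem isQuadraticallyStable_spectrum (hne : Γ.Nonempty) {K : Op Γ} (hK : IsSelfAdjoint K)
    {S : ℝ} (hS0 : 0 ≤ S) (hS : ∀ (s : Finset Γ) x', ∑ x ∈ s, moment K x x' ≤ S) :
    IsQuadraticallyStable (fun b => spectrum ℝ (harper K b)) (S ^ 2 + S) (S * ‖(1 : Op Γ)‖) where
  isCompact b := spectrum.isCompact _
  nonempty b := by
    have := nontrivial_op hne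
    obtain ⟨hsa, -, -⟩ := isSelfAdjoint_harper_and_kernel hK hS0 hS b
    have h := spectrum.nonempty (harper K b)
    rw [← hsa.spectrumRestricts.algebraMap_image] at h
    exact h.of_image
  const_nonneg := by positivity
  abs_le_bound b l hl := by
    obtain ⟨-, -, hn⟩ := isSelfAdjoint_harper_and_kernel hK hS0 hS b
    refine (spectrum.norm_le_norm_mul_of_mem hl).trans ?_
    gcongr
  lower_bound b₀ w u m h b := by
    obtain ⟨h1, h2, -⟩ := isSelfAdjoint_harper_and_kernel hK hS0 hS b
    obtain ⟨h3, h4, -⟩ := isSelfAdjoint_harper_and_kernel hK hS0 hS b₀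
    exact spectrum_quadratic_lower_bound hK hS0 hS h1 h3 h2 h4 h

/-- The spectrum of a self-adjoint operator is real, so distances to it can be computed on its real
spectrum. -/
theorem le_infDist_spectrum_iff (hne : Γ.Nonempty) {T : Op Γ} (hT : IsSelfAdjoint T) (z : ℂ)
    (ε : ℝ) :
    ε ≤ Metric.infDist z (spectrum ℂ T) ↔ ∀ l ∈ spectrum ℝ T, ε ≤ ‖z - l‖ := by
  have := nontrivial_op hne
  rw [Metric.le_infDist (spectrum.nonempty T), ← hT.spectrumRestricts.algebraMap_image,
    Set.forall_mem_image]
  exact forall₂_congr fun l _ => by rw [dist_eq_norm]; rfl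

end HarperLike

theorem theorem1 (Γ : Set HarperLike.Plane) (hne : Γ.Nonempty)
    (hΓ : HarperLike.IsNearIntegerLattice Γ)
    (α : ℝ) (hα : 3 < α) (K : HarperLike.Op Γ) (hK : HarperLike.MemH α K) :
    -- the operators `K_b` are well defined, bounded and self-adjoint
    (∀ b : ℝ, IsSelfAdjoint (HarperLike.harper K b) ∧
      ∀ x x' : Γ, HarperLike.kernel (HarperLike.harper K b) x x' =
        Complex.exp (Complex.I * b * HarperLike.flux x x') * HarperLike.kernel K x x') ∧
    -- (i) stability of the resolvent set
    (∀ (b₀ : ℝ) (ε : ℝ), 0 < ε → ∃ δ > (0 : ℝ), ∃ η > (0 : ℝ), ∀ z : ℂ,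
      ε ≤ Metric.infDist z (spectrum ℂ (HarperLike.harper K b₀)) →
        ∀ b : ℝ, |b - b₀| < δ →
          η ≤ Metric.infDist z (spectrum ℂ (HarperLike.harper K b))) ∧
    -- (ii) the spectral extremes are Lipschitz in `b`
    (∃ C : NNReal,
      LipschitzWith C (fun b : ℝ => sSup (spectrum ℝ (HarperLike.harper K b))) ∧
      LipschitzWith C (fun b : ℝ => sInf (spectrum ℝ (HarperLike.harper K b)))) ∧
    -- (iii) the edges of a gap that stays open on `[p, q]` are Lipschitz on `[p, q]`; the gap is
    -- followed by a continuous curve `γ` in the resolvent sets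
    (4 < α → ∀ p q b₀ : ℝ, b₀ ∈ Set.Icc p q →
      ∀ a c : ℝ, HarperLike.IsGap (spectrum ℝ (HarperLike.harper K b₀)) a c →
      ∀ γ : ℝ → ℝ, ContinuousOn γ (Set.Icc p q) → γ b₀ ∈ Set.Ioo a c →
        (∀ b ∈ Set.Icc p q, γ b ∉ spectrum ℝ (HarperLike.harper K b)) →
      ∃ eMinus ePlus : ℝ → ℝ, eMinus b₀ = a ∧ ePlus b₀ = c ∧
        (∀ b ∈ Set.Icc p q,
          HarperLike.IsGap (spectrum ℝ (HarperLike.harper K b)) (eMinus b) (ePlus b) ∧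
            γ b ∈ Set.Ioo (eMinus b) (ePlus b)) ∧
        ∃ C : NNReal, LipschitzOnWith C eMinus (Set.Icc p q) ∧
          LipschitzOnWith C ePlus (Set.Icc p q)) := by
  obtain ⟨S, hS0, hS⟩ := hK.exists_sum_moment_le hΓ hα
  have hself b := HarperLike.isSelfAdjoint_harper_and_kernel hK.1 hS0 hS b
  have h := HarperLike.isQuadraticallyStable_spectrum hne hK.1 hS0 hS
  refine ⟨fun b => ⟨(hself b).1, fun x x' => by rw [(hself b).2.1]; rfl⟩, fun b₀ ε hε => ?_,
    ⟨_, h.lipschitzWith_sSup, h.lipschitzWith_sInf⟩,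
    fun _ p q b₀ hb₀ a c hgap γ hγ hγ₀ hσ => h.exists_lipschitz_edges hb₀ hgap hγ hγ₀ hσ⟩
  obtain ⟨δ, hδ, η, hη, H⟩ := h.exists_le_norm_sub b₀ hε
  refine ⟨δ, hδ, η, hη, fun z hz b hb => ?_⟩
  rw [HarperLike.le_infDist_spectrum_iff hne (hself b).1]
  exact H z ((HarperLike.le_infDist_spectrum_iff hne (hself b₀).1 z ε).mp hz) b hb
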